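/- Let $m\ge 1$ parties $A_1,\dots,A_m$ and steps $l=1,\dots,L$ be given, and for each $l$ an ensemble $\mathcal E^l=\{\eta^l_i,\rho^l_i\}_{i=1}^{n_l}$ of density operators $\rho^l_i$ on $\bigotimes_{k=1}^m\mathbb C^{d^l_k}$ with probabilities $\eta^l_i>0$, $\sum_i\eta^l_i=1$. For $\vec c=(c_1,\dots,c_L)$ with $1\le c_l\le n_l$ put $\eta_{\vec c}=\prod_l\eta^l_{c_l}$ and $\rho_{\vec c}=\bigotimes_l\rho^l_{c_l}$, and let $\bigotimes_l\mathcal E^l=\{\eta_{\vec c},\rho_{\vec c}\}_{\vec c}$, an ensemble of $m$-party states in which party $A_k$ holds $\bigotimes_l\mathbb C^{d^l_k}$. A measurement is a finite family $\{M_i\}$ of positive semidefinite operators with $\sum_iM_i=\mathbb 1$. An operator is separable if it is a finite sum of tensor products over the parties of positive semidefinite operators; a measurement is separable if all its operators are, and LOCC if it is realized by a protocol of local operations and classical communication among $A_1,\dots,A_m$ with finitely many rounds. A Hermitian operator $E$ is block positive if $\operatorname{Tr}(E\sigma)\ge 0$ for every separable state $\sigma$. For an ensemble $\mathcal E=\{\eta_i,\rho_i\}_i$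 let $p_{\mathsf L}(\mathcal E)$ and $p_{\mathsf{SEP}}(\mathcal E)$ be the maximum of $\sum_i\eta_i\operatorname{Tr}(\rho_iM_i)$ over the LOCC, respectively separable, measurements $\{M_i\}_i$. Then the maxima $p_{\mathsf L}(\mathcal E^1),\dots,p_{\mathsf L}(\mathcal E^L)$, $p_{\mathsf L}(\bigotimes_l\mathcal E^l)$ and $p_{\mathsf{SEP}}(\bigotimes_l\mathcal E^l)$ are attained and satisfy $$\prod_{l=1}^Lp_{\mathsf L}(\mathcal E^l)=p_{\mathsf L}\Big(\bigotimes_{l=1}^L\mathcal E^l\Big)=p_{\mathsf{SEP}}\Big(\bigotimes_{l=1}^L\mathcal E^l\Big)$$ if and only if there exist LOCC measurements $\{M^1_i\}_{i=1}^{n_1},\dots,\{M^L_i\}_{i=1}^{n_L}$, where $\{M^l_i\}_i$ acts on $\bigotimes_k\mathbb C^{d^l_k}$, and a Hermitian operator $H$ such that, for every $\vec c$, the operator $H-\eta_{\vec c}\rho_{\vec c}$ is block positive and $$\operatorname{Tr}\big[M_{\vec c}\,(H-\eta_{\vec c}\rho_{\vec c})\big]=0,\qquad M_{\vec c}=M^1_{c_1}\otimes\cdots\otimes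 M^L_{c_L}.$$ -/

import Mathlib

open scoped Matrix ComplexOrder

namespace MultiParty

/-- The tensor product `⨂ₚ A p` of finitely many matrices. The space `⨂ₚ ℂ^(α p)` is indexed by
the functions choosing one basis index per factor. -/
def tensorOp {P : Type} [Fintype P] {α β : P → Type} (A : ∀ p, Matrix (α p) (β p) ℂ) :
    Matrix (∀ p, α p) (∀ p, β p) ℂ :=
  Matrix.of fun x y => ∏ p, A p (x p) (y p)

/-- Operators on the multi-party space `⨂ₚ ℂ^(ι p)`. -/
abbrev Op {P : Type} (ι : P → Type) : Type := Matrix (∀ p, ι p) (∀ p, ι p) ℂ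

section Basic

variable {P : Type} [Fintype P] [DecidableEq P] {o : Type} [Fintype o]

/-- An ensemble of states of a multi-party system: states `ρ i` prepared with nonzero
probabilities `η i`. -/
structure Ensemble (ι : P → Type) [∀ p, Fintype (ι p)] (o : Type) [Fintype o] where
  η : o → ℝ
  ρ : o → Op ι
  η_pos : ∀ i, 0 < η i
  η_sum : ∑ i, η i = 1
  ρ_psd : ∀ i, (ρ i).PosSemidef
  ρ_trace : ∀ i, (ρ i).trace = 1

/-- A measurement with outcomes in `o`. -/
def IsMeasurement {ι : P → Type} [∀ p, Fintype (ι p)] [∀ p, DecidableEq (ι p)]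
    (M : o → Op ι) : Prop :=
  (∀ i, (M i).PosSemidef) ∧ ∑ i, M i = 1

/-- A positive semidefinite operator is separable if it is a finite sum of tensor products, over
the parties, of positive semidefinite operators. -/
def IsSeparable {ι : P → Type} [∀ p, Fintype (ι p)] (E : Op ι) : Prop :=
  E.PosSemidef ∧ ∃ (r : ℕ) (F : Fin r → ∀ p, Matrix (ι p) (ι p) ℂ),
    (∀ s p, (F s p).PosSemidef) ∧ E = ∑ s, tensorOp (F s)

/-- A Hermitian operator is block positive if its mean value is nonnegative in every separable
state (the trace is real, both factors being Hermitian). -/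
def IsBlockPositive {ι : P → Type} [∀ p, Fintype (ι p)] (E : Op ι) : Prop :=
  E.IsHermitian ∧ ∀ σ : Op ι, IsSeparable σ → σ.trace = 1 → 0 ≤ (E * σ).trace.re

/-- A measurement all of whose operators are separable. -/
def IsSepMeasurement {ι : P → Type} [∀ p, Fintype (ι p)] [∀ p, DecidableEq (ι p)]
    (M : o → Op ι) : Prop :=
  IsMeasurement M ∧ ∀ i, IsSeparable (M i)

end Basic

/-- `RealizedByLOCC ι M`: the operators `M b`, `b : o`, are the effects of a protocol of local
operations and classical communication, with finitely many rounds, on the system `⨂ₚ ℂ^(ι p)`.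

* `announce`: the protocol stops, and the outcome `a` is announced.
* `round`: party `k` performs a local quantum instrument with Kraus operators `A j k`, where
  `∑ j, (A j k)ᴴ * A j k = 1`, and broadcasts the result `j`; then each other party `p` may apply
  a local isometry `A j p` that depends on `j` (the identity, the adjoining of an ancilla, ...).
  The output spaces `ℂ^(κ j p)` are arbitrary. The protocol continues with a protocol on them
  that may depend on `j`; its acting party may depend on `j` as well, so that the whole
  transcript is available to all parties at all times.

Discarding information, general local channels and shared randomness are covered: a party
performs an instrument whose result has no influence on the rest. Post-processing is
covered, since distinct branches may announce the same outcome. -/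
inductive RealizedByLOCC {P o : Type} [Fintype P] [DecidableEq P] [DecidableEq o] :
    ∀ (ι : P → Type) [∀ p, Fintype (ι p)] [∀ p, DecidableEq (ι p)], (o → Op ι) → Prop
  | announce (ι : P → Type) [∀ p, Fintype (ι p)] [∀ p, DecidableEq (ι p)] (a : o) :
      RealizedByLOCC ι (fun b => if b = a then 1 else 0)
  | round (ι : P → Type) [∀ p, Fintype (ι p)] [∀ p, DecidableEq (ι p)] (k : P) (r : ℕ)
      (κ : Fin r → P → Type) [∀ j p, Fintype (κ j p)] [∀ j p, DecidableEq (κ j p)]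
      (A : ∀ j p, Matrix (κ j p) (ι p) ℂ)
      (hk : ∑ j, (A j k)ᴴ * A j k = 1)
      (hp : ∀ j p, p ≠ k → (A j p)ᴴ * A j p = 1)
      (N : ∀ j, o → Op (κ j))
      (hN : ∀ j, RealizedByLOCC (κ j) (N j)) :
      RealizedByLOCC ι (fun b => ∑ j, (tensorOp (A j))ᴴ * N j b * tensorOp (A j))

section Discrimination

variable {P : Type} [Fintype P] [DecidableEq P] {o : Type} [Fintype o]

/-- A measurement that can be realized by LOCC. -/
def IsLOCCMeasurement [DecidableEq o] {ι : P → Type} [∀ p, Fintype (ι p)]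
    [∀ p, DecidableEq (ι p)] (M : o → Op ι) : Prop :=
  IsMeasurement M ∧ RealizedByLOCC ι M

/-- The average probability `∑ᵢ ηᵢ Tr(ρᵢ Mᵢ)` of correctly guessing the prepared state. -/
def Ensemble.success {ι : P → Type} [∀ p, Fintype (ι p)] (E : Ensemble ι o) (M : o → Op ι) : ℝ :=
  ∑ i, E.η i * (E.ρ i * M i).trace.re

/-- `p` is the maximum of the average success probability over the LOCC measurements. -/
def Ensemble.IsPL [DecidableEq o] {ι : P → Type} [∀ p, Fintype (ι p)] [∀ p, DecidableEq (ι p)]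
    (E : Ensemble ι o) (p : ℝ) : Prop :=
  IsGreatest {v | ∃ M : o → Op ι, IsLOCCMeasurement M ∧ E.success M = v} p

/-- `p` is the maximum of the average success probability over the separable measurements. -/
def Ensemble.IsPSEP {ι : P → Type} [∀ p, Fintype (ι p)] [∀ p, DecidableEq (ι p)]
    (E : Ensemble ι o) (p : ℝ) : Prop :=
  IsGreatest {v | ∃ M : o → Op ι, IsSepMeasurement M ∧ E.success M = v} p

end Discrimination

section Sequence

variable {P S : Type} [Fintype S]

/-- The tensor product, over the steps `l : S`, of operators on the multi-party spaces
`⨂ₚ ℂ^(ι l p)`. The result is regarded as an operator on the multi-party space in which party `p`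
holds `⨂ₗ ℂ^(ι l p)`, its shares of all the steps. -/
def stepTensor {ι : S → P → Type} (A : ∀ l, Op (ι l)) : Op (fun p => ∀ l, ι l p) :=
  (tensorOp A).submatrix (fun x l p => x p l) (fun x l p => x p l)

theorem tensorOp_posSemidef [DecidableEq S] {α : S → Type} [∀ l, Fintype (α l)]
    (A : ∀ l, Matrix (α l) (α l) ℂ) (hA : ∀ l, (A l).PosSemidef) :
    (tensorOp A).PosSemidef := by
  classical
  have h : ∀ l, ∃ B : Matrix (α l) (α l) ℂ, A l = Bᴴ * B := fun l => by
    open scoped MatrixOrder in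
    obtain ⟨B, hB⟩ := CStarAlgebra.nonneg_iff_eq_star_mul_self.mp (hA l).nonneg
    exact ⟨B, hB⟩
  choose B hB using h
  have : tensorOp A = (tensorOp B)ᴴ * tensorOp B := by
    ext x y
    simp only [tensorOp, Matrix.of_apply, Matrix.mul_apply, Matrix.conjTranspose_apply, hB]
    rw [Fintype.prod_sum]
    refine Finset.sum_congr rfl fun z _ => ?_
    rw [star_prod, Finset.prod_mul_distrib]
  rw [this]
  exact Matrix.posSemidef_conjTranspose_mul_self _

theorem stepTensor_posSemidef [Fintype P] [DecidableEq P] [DecidableEq S] {ι : S → P → Type} [∀ l p, Fintype (ι l p)]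
    (A : ∀ l, Op (ι l)) (hA : ∀ l, (A l).PosSemidef) : (stepTensor A).PosSemidef := by
  classical
  exact (tensorOp_posSemidef A hA).submatrix _

theorem stepTensor_trace [Fintype P] [DecidableEq P] [DecidableEq S] {ι : S → P → Type}
    [∀ l p, Fintype (ι l p)] (A : ∀ l, Op (ι l)) :
    (stepTensor A).trace = ∏ l, (A l).trace := by
  simp only [Matrix.trace, Matrix.diag]
  rw [Fintype.prod_sum]
  exact Fintype.sum_equiv (Equiv.piComm fun p l => ι l p) _ _ fun x => rfl

/-- The sequence ensemble `⨂ₗ E l`: for `c = (c l)ₗ`, the state `⨂ₗ ρˡ_(c l)` is prepared with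
probability `∏ₗ ηˡ_(c l)`. -/
def seqEnsemble [Fintype P] [DecidableEq P] [DecidableEq S] {ι : S → P → Type}
    [∀ l p, Fintype (ι l p)] {o : S → Type} [∀ l, Fintype (o l)]
    (E : ∀ l, Ensemble (ι l) (o l)) : Ensemble (fun p => ∀ l, ι l p) (∀ l, o l) where
  η c := ∏ l, (E l).η (c l)
  ρ c := stepTensor fun l => (E l).ρ (c l)
  η_pos c := Finset.prod_pos fun l _ => (E l).η_pos (c l)
  η_sum := by
    rw [← Fintype.prod_sum]
    exact Finset.prod_eq_one fun l _ => (E l).η_sum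
  ρ_psd c := stepTensor_posSemidef _ fun l => (E l).ρ_psd (c l)
  ρ_trace c := by
    rw [stepTensor_trace]
    exact Finset.prod_eq_one fun l _ => (E l).ρ_trace (c l)

end Sequence

end MultiParty

/-! Optimal separable discrimination is a conic program over the cone of separable operators. The
identity is an order unit of that cone: expanding `⨂ₚ tₚ 1 = ⨂ₚ ((tₚ 1 - Fₚ) + Fₚ)` writes
`⨂ₚ tₚ 1 - ⨂ₚ Fₚ` as a sum of tensor products of positive semidefinite operators. Hence the Riesz
extension theorem provides a dual optimum `H` without duality gap, and a separable measurement `M`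
is optimal if and only if it satisfies the complementary slackness conditions
`Tr (M i (H - ηᵢ ρᵢ)) = 0` with some dual feasible `H`.

A product of LOCC measurements of the steps is an LOCC measurement of the sequence, and its success
probability is the product of those of the factors. If it is optimal, then so is each factor:
replacing one of them by a better measurement would improve the product, whose value is positive. -/

namespace MultiParty

section Trace

theorem isSelfAdjoint_trace_mul {n R : Type*} [Fintype n] [CommSemiring R] [StarRing R]
    {A B : Matrix n n R} (hA : A.IsHermitian) (hB : B.IsHermitian) :
    IsSelfAdjoint (A * B).trace := by
  rw [IsSelfAdjoint, ← Matrix.trace_conjTranspose, Matrix.conjTranspose_mul, hA.eq, hB.eq,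
    Matrix.trace_mul_comm]

theorem trace_mul_nonneg {n 𝕜 : Type*} [Fintype n] [RCLike 𝕜] {A B : Matrix n n 𝕜}
    (hA : A.PosSemidef) (hB : B.PosSemidef) : 0 ≤ (A * B).trace := by
  classical
  open scoped MatrixOrder in
  obtain ⟨C, rfl⟩ := CStarAlgebra.nonneg_iff_eq_star_mul_self.mp hB.nonneg
  have h := (hA.mul_mul_conjTranspose_same C).trace_nonneg
  rwa [Matrix.mul_assoc, Matrix.trace_mul_comm, Matrix.mul_assoc] at h

open scoped MatrixOrder Matrix.Norms.L2Operator in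
theorem exists_posSemidef_smul_one_sub {n : Type*} [Finite n] [DecidableEq n]
    {A : Matrix n n ℂ} (hA : A.IsHermitian) :
    ∃ t : ℝ, (t • (1 : Matrix n n ℂ) - A).PosSemidef := by
  have := Fintype.ofFinite n
  refine ⟨‖A‖, ?_⟩
  simpa only [Matrix.le_iff, Algebra.algebraMap_eq_smul_one] using
    IsSelfAdjoint.le_algebraMap_norm_self hA

theorem exists_forall_eq_trace_mul {m n R : Type*} [Fintype m] [Fintype n] [CommSemiring R]
    (f : Matrix m n R →ₗ[R] R) : ∃ G : Matrix n m R, ∀ X, f X = (G * X).trace := by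
  classical
  let G : Matrix n m R := Matrix.of fun j i => f (Matrix.single i j 1)
  have hf : f = Matrix.traceLinearMap n R R ∘ₗ mulLeftLinearMap n R G := by
    refine Matrix.ext_linearMap R fun i j => LinearMap.ext_ring ?_
    simp [G, Matrix.trace_mul_single]
  exact ⟨G, LinearMap.congr_fun hf⟩

theorem exists_isHermitian_forall_eq_re_trace_mul {n : Type*} [Fintype n]
    (f : Matrix n n ℂ →ₗ[ℝ] ℝ) :
    ∃ H : Matrix n n ℂ, H.IsHermitian ∧ ∀ X, X.IsHermitian → f X = (H * X).trace.re := by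
  obtain ⟨G, hG⟩ := exists_forall_eq_trace_mul (Module.Dual.extendRCLike f : Matrix n n ℂ →ₗ[ℂ] ℂ)
  have hf : ∀ X, f X = (G * X).trace.re := fun X => by
    rw [← hG]
    exact (Module.Dual.re_extendRCLike_apply (𝕜 := ℂ) f X).symm
  refine ⟨(2⁻¹ : ℝ) • (G + Gᴴ), (Matrix.isHermitian_add_transpose_self G).smul (.all _),
    fun X hX => ?_⟩
  have h_adj : (Gᴴ * X).trace.re = (G * X).trace.re := by
    rw [← Complex.conj_re, ← Complex.star_def, ← Matrix.trace_conjTranspose,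
      Matrix.conjTranspose_mul, Matrix.conjTranspose_conjTranspose, hX.eq, Matrix.trace_mul_comm]
  rw [Matrix.smul_mul, Matrix.add_mul, Matrix.trace_smul, Matrix.trace_add, Complex.smul_re,
    Complex.add_re, h_adj, ← hf, smul_eq_mul]
  ring

end Trace

section ConicDuality

variable {V o : Type*} [AddCommGroup V] [Module ℝ V] [Fintype o]

theorem exists_linearMap_extension_forall_le (C : PointedCone ℝ V) (D : Submodule ℝ V)
    (hD : ∀ x, ∃ d ∈ D, d + x ∈ C) (φ : o → V →ₗ[ℝ] ℝ) (τ : V →ₗ[ℝ] ℝ)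
    (hτ : ∀ M : o → V, (∀ c, M c ∈ C) → ∑ c, M c ∈ D → ∑ c, φ c (M c) ≤ τ (∑ c, M c)) :
    ∃ h : V →ₗ[ℝ] ℝ, (∀ d ∈ D, h d = τ d) ∧ ∀ c, ∀ x ∈ C, φ c x ≤ h x := by
  classical
  rcases isEmpty_or_nonempty o with _ | ⟨⟨c₀⟩⟩
  · exact ⟨τ, fun _ _ => rfl, isEmptyElim⟩
  let total : (o → V) →ₗ[ℝ] V := ∑ c, LinearMap.proj c
  let Φ : (o → V) →ₗ[ℝ] ℝ := ∑ c, φ c ∘ₗ LinearMap.proj c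
  have total_apply : ∀ M, total M = ∑ c, M c := fun M => by simp [total]
  have Φ_apply : ∀ M, Φ M = ∑ c, φ c (M c) := fun M => by simp [Φ]
  have total_single : ∀ c x, total (Pi.single c x) = x := fun c x => by simp [total_apply]
  have Φ_single : ∀ c x, Φ (Pi.single c x) = φ c x := fun c x => by
    rw [Φ_apply, Fintype.sum_eq_single c fun b hb => by simp [hb], Pi.single_eq_same]
  -- Extend `τ ∘ total - Φ` to a functional `g` nonnegative on `C ^ o`. As `g + Φ` vanishes on the
  -- families of total `0`, `x ↦ (g + Φ) (Pi.single c x)` does not depend on the slot `c`.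
  obtain ⟨g, hgD, hgC⟩ := riesz_extension (Submodule.pi Set.univ fun _ => C)
    ⟨D.comap total, (τ ∘ₗ total - Φ).domRestrict (D.comap total)⟩
    (fun M hM => by
      have := hτ M (fun c => hM c trivial) (by rw [← total_apply]; exact M.2)
      simpa [Φ_apply, total_apply] using this)
    (fun M => by
      choose d hd hdM using fun c => hD (M c)
      exact ⟨⟨d, by simpa [total_apply] using D.sum_mem fun c _ => hd c⟩, fun c _ => hdM c⟩)
  have hg : ∀ M, total M ∈ D → g M = τ (total M) - Φ M := fun M hM => hgD ⟨M, hM⟩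
  refine ⟨(g + Φ) ∘ₗ LinearMap.single ℝ (fun _ => V) c₀, fun d hd => ?_, fun c x hx => ?_⟩
  · have := hg (Pi.single c₀ d) (by rwa [total_single])
    simp [this, total_single]
  · have h_diff := hg (Pi.single c x - Pi.single c₀ x) (by simp [total_single])
    have h_pos := hgC (Pi.single c x) fun b _ => by
      rcases eq_or_ne b c with rfl | hb
      · simpa
      · simp [hb]
    simp only [map_sub, total_single, sub_self, map_zero, Φ_single] at h_diff
    simp only [LinearMap.comp_apply, LinearMap.add_apply, LinearMap.coe_single, Φ_single]
    linarith

theorem exists_sub_eq_of_mem_span (C : PointedCone ℝ V) {x : V}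
    (hx : x ∈ Submodule.span ℝ (C : Set V)) : ∃ y ∈ C, ∃ z ∈ C, y - z = x := by
  induction hx using Submodule.span_induction with
  | mem x hx => exact ⟨x, hx, 0, C.zero_mem, sub_zero x⟩
  | zero => exact ⟨0, C.zero_mem, 0, C.zero_mem, sub_zero 0⟩
  | add _ _ _ _ ihx ihx' =>
    obtain ⟨y, hy, z, hz, rfl⟩ := ihx
    obtain ⟨y', hy', z', hz', rfl⟩ := ihx'
    exact ⟨y + y', C.add_mem hy hy', z + z', C.add_mem hz hz', add_sub_add_comm ..⟩
  | smul r _ _ ih =>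
    obtain ⟨y, hy, z, hz, rfl⟩ := ih
    rcases le_total 0 r with hr | hr
    · exact ⟨r • y, C.smul_mem hr hy, r • z, C.smul_mem hr hz, (smul_sub ..).symm⟩
    · exact ⟨-r • z, C.smul_mem (neg_nonneg.2 hr) hz, -r • y, C.smul_mem (neg_nonneg.2 hr) hy,
        by module⟩

theorem exists_dual_functional (C : PointedCone ℝ V) {e : V} (heC : e ∈ C)
    (he : ∀ x ∈ C, ∃ t : ℝ, t • e - x ∈ C) (φ : o → V →ₗ[ℝ] ℝ) (τ : V →ₗ[ℝ] ℝ)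
    (hτ : ∀ (a : ℝ) (M : o → V), (∀ c, M c ∈ C) → ∑ c, M c = a • e →
      ∑ c, φ c (M c) ≤ a * τ e) :
    ∃ h : V →ₗ[ℝ] ℝ, h e = τ e ∧ ∀ c, ∀ x ∈ C, φ c x ≤ h x := by
  have heD : e ∈ Submodule.span ℝ {e} := Submodule.mem_span_singleton_self e
  have mem_span {x} (hx : x ∈ C) : x ∈ Submodule.span ℝ (C : Set V) := Submodule.subset_span hx
  -- `C` need not span `V`; the complement `W` makes every vector absorbable into `C`.
  obtain ⟨W, hW⟩ := Submodule.exists_isCompl (Submodule.span ℝ (C : Set V))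
  have h_absorb : ∀ x, ∃ d ∈ Submodule.span ℝ {e} ⊔ W, d + x ∈ C := fun x => by
    obtain ⟨v, hv, w, hw, rfl⟩ := Submodule.mem_sup.1 (hW.sup_eq_top ▸ Submodule.mem_top (x := x))
    obtain ⟨y, hy, z, hz, rfl⟩ := exists_sub_eq_of_mem_span C hv
    obtain ⟨t, ht⟩ := he z hz
    refine ⟨t • e + -w, Submodule.add_mem_sup (Submodule.smul_mem _ t heD) (W.neg_mem hw), ?_⟩
    convert C.add_mem ht hy using 1
    abel
  have h_le : ∀ M : o → V, (∀ c, M c ∈ C) → ∑ c, M c ∈ Submodule.span ℝ {e} ⊔ W →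
      ∑ c, φ c (M c) ≤ τ (∑ c, M c) := fun M hM hMD => by
    obtain ⟨_, hd, w, hw, hdw⟩ := Submodule.mem_sup.1 hMD
    obtain ⟨a, rfl⟩ := Submodule.mem_span_singleton.1 hd
    have hw_span : w ∈ Submodule.span ℝ (C : Set V) := by
      rw [← add_sub_cancel_left (a • e) w, hdw]
      exact Submodule.sub_mem _ (Submodule.sum_mem _ fun c _ => mem_span (hM c))
        (Submodule.smul_mem _ a (mem_span heC))
    rw [Submodule.disjoint_def.1 hW.disjoint w hw_span hw, add_zero] at hdw
    simpa [← hdw] using hτ a M hM hdw.symm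
  obtain ⟨h, hhD, hhC⟩ := exists_linearMap_extension_forall_le C _ h_absorb φ τ h_le
  exact ⟨h, hhD e (Submodule.mem_sup_left heD), hhC⟩

end ConicDuality

section TensorOp

variable {P : Type} [Fintype P]

/-- The tensor product `⨂ₚ A p` of matrices as a multilinear map in the factors. -/
def tensorMultilinear (α β : P → Type) :
    MultilinearMap ℂ (fun p => Matrix (α p) (β p) ℂ) (Matrix (∀ p, α p) (∀ p, β p) ℂ) where
  toFun := tensorOp
  map_update_add' A p B B' := by
    ext x y
    exact ((MultilinearMap.mkPiAlgebra ℂ P ℂ).compLinearMap fun p =>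
      Matrix.entryLinearMap ℂ ℂ (x p) (y p)).map_update_add A p B B'
  map_update_smul' A p c B := by
    ext x y
    exact ((MultilinearMap.mkPiAlgebra ℂ P ℂ).compLinearMap fun p =>
      Matrix.entryLinearMap ℂ ℂ (x p) (y p)).map_update_smul A p c B

theorem tensorOp_sum [DecidableEq P] {α β s : P → Type} [∀ p, Fintype (s p)]
    (A : ∀ p, s p → Matrix (α p) (β p) ℂ) :
    tensorOp (fun p => ∑ i, A p i) = ∑ i : ∀ p, s p, tensorOp fun p => A p (i p) :=
  (tensorMultilinear α β).map_sum A

theorem tensorOp_update_sum [DecidableEq P] {α β : P → Type} {s : Type} [Fintype s]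
    (A : ∀ p, Matrix (α p) (β p) ℂ) (k : P) (B : s → Matrix (α k) (β k) ℂ) :
    tensorOp (Function.update A k (∑ i, B i)) = ∑ i, tensorOp (Function.update A k (B i)) :=
  (tensorMultilinear α β).map_update_sum Finset.univ k B A

theorem tensorOp_smul {α β : P → Type} (t : P → ℝ) (A : ∀ p, Matrix (α p) (β p) ℂ) :
    tensorOp (fun p => t p • A p) = (∏ p, t p) • tensorOp A :=
  ((tensorMultilinear α β).restrictScalars ℝ).map_smul_univ t A

theorem tensorOp_conjTranspose {α β : P → Type} (A : ∀ p, Matrix (α p) (β p) ℂ) :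
    (tensorOp A)ᴴ = tensorOp fun p => (A p)ᴴ := by
  ext x y
  exact star_prod Finset.univ _

theorem tensorOp_mul [DecidableEq P] {α β γ : P → Type} [∀ p, Fintype (β p)]
    (A : ∀ p, Matrix (α p) (β p) ℂ) (B : ∀ p, Matrix (β p) (γ p) ℂ) :
    tensorOp A * tensorOp B = tensorOp fun p => A p * B p := by
  ext x y
  simp only [tensorOp, Matrix.of_apply, Matrix.mul_apply, Fintype.prod_sum,
    Finset.prod_mul_distrib]

theorem tensorOp_one {α : P → Type} [∀ p, DecidableEq (α p)] :
    tensorOp (fun p => (1 : Matrix (α p) (α p) ℂ)) = 1 := by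
  ext x y
  simp only [tensorOp, Matrix.of_apply, Matrix.one_apply, funext_iff, Fintype.prod_ite_zero,
    Finset.prod_const_one]

theorem sum_conjTranspose_tensorOp_mul_tensorOp [DecidableEq P] {ι : P → Type}
    [∀ p, DecidableEq (ι p)] {s : Type} [Fintype s] {κ : s → P → Type} [∀ j p, Fintype (κ j p)]
    {A : ∀ j p, Matrix (κ j p) (ι p) ℂ} {k : P}
    (hk : ∑ j, (A j k)ᴴ * A j k = 1) (hp : ∀ j p, p ≠ k → (A j p)ᴴ * A j p = 1) :
    ∑ j, (tensorOp (A j))ᴴ * tensorOp (A j) = 1 := by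
  have h_local : ∀ j, (fun p => (A j p)ᴴ * A j p) =
      Function.update (fun p => (1 : Matrix (ι p) (ι p) ℂ)) k ((A j k)ᴴ * A j k) := fun j =>
    Function.eq_update_iff.2 ⟨rfl, hp j⟩
  simp only [tensorOp_conjTranspose, tensorOp_mul, h_local]
  rw [← tensorOp_update_sum, hk, Function.update_eq_self, tensorOp_one]

end TensorOp

section Kronecker

open scoped Kronecker

theorem conjTranspose_kronecker_mul_kronecker {l m n p R : Type*} [Fintype l] [Fintype n]
    [CommSemiring R] [StarRing R] (A : Matrix l m R) (B : Matrix n p R) :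
    (A ⊗ₖ B)ᴴ * (A ⊗ₖ B) = (Aᴴ * A) ⊗ₖ (Bᴴ * B) := by
  rw [Matrix.conjTranspose_kronecker, Matrix.mul_kronecker_mul]

theorem sum_kronecker {l m n p s R : Type*} [Fintype s] [CommSemiring R]
    (A : s → Matrix l m R) (B : Matrix n p R) : (∑ j, A j) ⊗ₖ B = ∑ j, A j ⊗ₖ B :=
  LinearMap.map_sum₂ (Matrix.kroneckerBilinear (R := R) (α := R)) Finset.univ A B

theorem kronecker_sum {l m n p s R : Type*} [Fintype s] [CommSemiring R]
    (A : Matrix l m R) (B : s → Matrix n p R) : A ⊗ₖ (∑ j, B j) = ∑ j, A ⊗ₖ B j :=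
  map_sum (Matrix.kroneckerBilinear (R := R) A) B Finset.univ

theorem submatrix_sum {l m n o s R : Type*} [Fintype s] [AddCommMonoid R]
    (A : s → Matrix m n R) (f : l → m) (g : o → n) :
    (∑ j, A j).submatrix f g = ∑ j, (A j).submatrix f g := by
  ext x y
  simp only [Matrix.submatrix_apply, Matrix.sum_apply]

end Kronecker

section PartyKron

open scoped Kronecker

variable {P : Type} {α β γ δ : P → Type}

/-- The tensor product of operators on two multi-party systems, regarded as an operator on the
system in which each party holds its shares of both. -/
def partyKron (A : Matrix (∀ p, α p) (∀ p, β p) ℂ) (B : Matrix (∀ p, γ p) (∀ p, δ p) ℂ) :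
    Matrix (∀ p, α p × γ p) (∀ p, β p × δ p) ℂ :=
  (A ⊗ₖ B).submatrix (Equiv.arrowProdEquivProdArrow P α γ) (Equiv.arrowProdEquivProdArrow P β δ)

theorem partyKron_mul [Fintype P] [DecidableEq P] {α' β' γ' : P → Type} [∀ p, Fintype (β p)]
    [∀ p, Fintype (β' p)] (A : Matrix (∀ p, α p) (∀ p, β p) ℂ)
    (A' : Matrix (∀ p, α' p) (∀ p, β' p) ℂ) (B : Matrix (∀ p, β p) (∀ p, γ p) ℂ)
    (B' : Matrix (∀ p, β' p) (∀ p, γ' p) ℂ) :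
    partyKron A A' * partyKron B B' = partyKron (A * B) (A' * B') := by
  rw [partyKron, partyKron, Matrix.submatrix_mul_equiv, ← Matrix.mul_kronecker_mul, partyKron]

theorem partyKron_conjTranspose (A : Matrix (∀ p, α p) (∀ p, β p) ℂ)
    (B : Matrix (∀ p, γ p) (∀ p, δ p) ℂ) : (partyKron A B)ᴴ = partyKron Aᴴ Bᴴ := by
  rw [partyKron, Matrix.conjTranspose_submatrix, Matrix.conjTranspose_kronecker, partyKron]

theorem partyKron_one [Fintype P] [∀ p, DecidableEq (α p)] [∀ p, DecidableEq (γ p)] :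
    partyKron (1 : Op α) (1 : Op γ) = 1 := by
  rw [partyKron, Matrix.one_kronecker_one, Matrix.submatrix_one_equiv]

theorem partyKron_zero_left (B : Matrix (∀ p, γ p) (∀ p, δ p) ℂ) :
    partyKron (0 : Matrix (∀ p, α p) (∀ p, β p) ℂ) B = 0 := by
  rw [partyKron, Matrix.zero_kronecker, Matrix.submatrix_zero]
  rfl

theorem partyKron_zero_right (A : Matrix (∀ p, α p) (∀ p, β p) ℂ) :
    partyKron A (0 : Matrix (∀ p, γ p) (∀ p, δ p) ℂ) = 0 := by
  rw [partyKron, Matrix.kronecker_zero]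
  rfl

theorem partyKron_sum_left {s : Type} [Fintype s] (A : s → Matrix (∀ p, α p) (∀ p, β p) ℂ)
    (B : Matrix (∀ p, γ p) (∀ p, δ p) ℂ) :
    partyKron (∑ i, A i) B = ∑ i, partyKron (A i) B := by
  simp only [partyKron, sum_kronecker, submatrix_sum]

theorem partyKron_sum_right {s : Type} [Fintype s] (A : Matrix (∀ p, α p) (∀ p, β p) ℂ)
    (B : s → Matrix (∀ p, γ p) (∀ p, δ p) ℂ) :
    partyKron A (∑ i, B i) = ∑ i, partyKron A (B i) := by
  simp only [partyKron, kronecker_sum, submatrix_sum]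

theorem tensorOp_kronecker [Fintype P] (A : ∀ p, Matrix (α p) (β p) ℂ)
    (B : ∀ p, Matrix (γ p) (δ p) ℂ) :
    tensorOp (fun p => A p ⊗ₖ B p) = partyKron (tensorOp A) (tensorOp B) := by
  ext x y
  exact Finset.prod_mul_distrib

end PartyKron

namespace RealizedByLOCC

open scoped Kronecker

variable {P o o' : Type} [Fintype P] [DecidableEq P] [DecidableEq o] [DecidableEq o']
  {ι κ : P → Type} [∀ p, Fintype (ι p)] [∀ p, DecidableEq (ι p)]
  [∀ p, Fintype (κ p)] [∀ p, DecidableEq (κ p)]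

theorem announce_of_eq {M : o → Op ι} (a : o) (hM : ∀ b, M b = if b = a then 1 else 0) :
    RealizedByLOCC ι M := by
  rw [funext hM]
  exact announce ι a

theorem round_of_eq {M : o → Op ι} (k : P) {r : ℕ} {κ : Fin r → P → Type}
    [∀ j p, Fintype (κ j p)] [∀ j p, DecidableEq (κ j p)] (A : ∀ j p, Matrix (κ j p) (ι p) ℂ)
    (hk : ∑ j, (A j k)ᴴ * A j k = 1) (hp : ∀ j p, p ≠ k → (A j p)ᴴ * A j p = 1)
    {N : ∀ j, o → Op (κ j)} (hN : ∀ j, RealizedByLOCC (κ j) (N j))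
    (hM : ∀ b, M b = ∑ j, (tensorOp (A j))ᴴ * N j b * tensorOp (A j)) :
    RealizedByLOCC ι M := by
  rw [funext hM]
  exact round ι k r κ A hk hp N hN

theorem comp_equiv {M : o → Op ι} (hM : RealizedByLOCC ι M) (f : o' ≃ o) :
    RealizedByLOCC ι fun b => M (f b) := by
  induction hM with
  | announce ι a => exact announce_of_eq (f.symm a) fun b => by simp only [f.eq_symm_apply]
  | round ι k r κ A hk hp N _ ih => exact round ι k r κ A hk hp _ ih

theorem submatrix_equiv {N : o → Op κ} (hN : RealizedByLOCC κ N) (e : ∀ p, ι p ≃ κ p) :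
    RealizedByLOCC ι fun b =>
      (N b).submatrix (Equiv.piCongrRight e) (Equiv.piCongrRight e) := by
  cases hN with
  | announce _ a =>
    refine announce_of_eq a fun b => ?_
    dsimp only
    split_ifs
    · exact Matrix.submatrix_one_equiv _
    · rfl
  | round _ k r κ' A hk hp N hN =>
    have h_mul : ∀ j p, ((A j p).submatrix id (e p))ᴴ * (A j p).submatrix id (e p) =
        ((A j p)ᴴ * A j p).submatrix (e p) (e p) := fun j p => by
      rw [Matrix.conjTranspose_submatrix, Matrix.submatrix_mul _ _ _ id _ Function.bijective_id]
    refine round_of_eq k (fun j p => (A j p).submatrix id (e p)) ?_ (fun j p h => ?_) hN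
      fun b => ?_
    · simp only [h_mul]
      rw [← submatrix_sum, hk, Matrix.submatrix_one_equiv]
    · rw [h_mul, hp j p h, Matrix.submatrix_one_equiv]
    · rw [submatrix_sum]
      rfl

theorem prod_announce {Q : o' → Op κ} (hQ : RealizedByLOCC κ Q) (a : o) :
    RealizedByLOCC (fun p => ι p × κ p)
      fun c : o × o' => partyKron (if c.1 = a then 1 else 0 : Op ι) (Q c.2) := by
  induction hQ with
  | announce κ a' =>
    refine announce_of_eq (a, a') fun c => ?_
    simp only [Prod.ext_iff]
    split_ifs <;>
      simp_all [partyKron_one, partyKron_zero_left, partyKron_zero_right]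
  | round κ k r κ' A hk hp N _ ih =>
    refine round_of_eq k (κ := fun j p => ι p × κ' j p)
      (fun j p => (1 : Matrix (ι p) (ι p) ℂ) ⊗ₖ A j p) ?_ (fun j p h => ?_) ih fun c => ?_
    · simp only [conjTranspose_kronecker_mul_kronecker]
      rw [← kronecker_sum, hk, Matrix.conjTranspose_one, Matrix.one_mul, Matrix.one_kronecker_one]
    · rw [conjTranspose_kronecker_mul_kronecker, hp j p h, Matrix.conjTranspose_one,
        Matrix.one_mul, Matrix.one_kronecker_one]
    · simp only [tensorOp_kronecker, tensorOp_one, partyKron_conjTranspose, partyKron_mul,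
        partyKron_sum_right, Matrix.conjTranspose_one, Matrix.one_mul, Matrix.mul_one]

theorem prod {N : o → Op ι} (hN : RealizedByLOCC ι N) {Q : o' → Op κ}
    (hQ : RealizedByLOCC κ Q) :
    RealizedByLOCC (fun p => ι p × κ p) fun c : o × o' => partyKron (N c.1) (Q c.2) := by
  induction hN with
  | announce ι a => exact hQ.prod_announce a
  | round ι k r κ' A hk hp N _ ih =>
    refine round_of_eq k (κ := fun j p => κ' j p × κ p)
      (fun j p => A j p ⊗ₖ (1 : Matrix (κ p) (κ p) ℂ)) ?_ (fun j p h => ?_) ih fun c => ?_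
    · simp only [conjTranspose_kronecker_mul_kronecker]
      rw [← sum_kronecker, hk, Matrix.conjTranspose_one, Matrix.one_mul, Matrix.one_kronecker_one]
    · rw [conjTranspose_kronecker_mul_kronecker, hp j p h, Matrix.conjTranspose_one,
        Matrix.one_mul, Matrix.one_kronecker_one]
    · simp only [tensorOp_kronecker, tensorOp_one, partyKron_conjTranspose, partyKron_mul,
        partyKron_sum_left, Matrix.conjTranspose_one, Matrix.one_mul, Matrix.mul_one]

theorem stepTensor_fin {L : ℕ} {ι : Fin L → P → Type} [∀ l p, Fintype (ι l p)]
    [∀ l p, DecidableEq (ι l p)] {o : Fin L → Type} [∀ l, DecidableEq (o l)]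
    {M : ∀ l, o l → Op (ι l)} (hM : ∀ l, RealizedByLOCC (ι l) (M l)) :
    RealizedByLOCC (fun p => ∀ l, ι l p)
      fun c : ∀ l, o l => MultiParty.stepTensor fun l => M l (c l) := by
  induction L with
  | zero =>
    refine announce_of_eq finZeroElim fun c => ?_
    rw [if_pos (Subsingleton.elim _ _)]
    ext x y
    rw [Subsingleton.elim x y, Matrix.one_apply_eq]
    exact Fin.prod_univ_zero fun l => M l (c l) (y · l) (y · l)
  | succ L ih =>
    have h := (((hM 0).prod (ih fun l => hM l.succ)).comp_equiv
      (Fin.consEquiv o).symm).submatrix_equiv fun p => (Fin.consEquiv fun l => ι l p).symm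
    convert h using 2 with c
    ext x y
    exact Fin.prod_univ_succ _

theorem stepTensor {S : Type} [Fintype S] [DecidableEq S] {ι : S → P → Type}
    [∀ l p, Fintype (ι l p)] [∀ l p, DecidableEq (ι l p)] {o : S → Type} [∀ l, DecidableEq (o l)]
    {M : ∀ l, o l → Op (ι l)} (hM : ∀ l, RealizedByLOCC (ι l) (M l)) :
    RealizedByLOCC (fun p => ∀ l, ι l p)
      fun c : ∀ l, o l => MultiParty.stepTensor fun l => M l (c l) := by
  let e := (Fintype.equivFin S).symm
  have h := ((stepTensor_fin fun l => hM (e l)).comp_equiv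
    (Equiv.piCongrLeft o e).symm).submatrix_equiv fun p => (Equiv.piCongrLeft (ι · p) e).symm
  convert h using 2 with c
  ext x y
  exact (Fintype.prod_equiv e _ _ fun l => rfl).symm

end RealizedByLOCC

section Separable

variable {P : Type} [Fintype P] {ι : P → Type} [∀ p, Fintype (ι p)]

theorem isSeparable_sum_tensorOp {s : Type} [Fintype s] {F : s → ∀ p, Matrix (ι p) (ι p) ℂ}
    (hF : ∀ i p, (F i p).PosSemidef) : IsSeparable (∑ i, tensorOp (F i)) := by
  classical
  exact ⟨Matrix.posSemidef_sum _ fun i _ => tensorOp_posSemidef _ (hF i), Fintype.card s,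
    fun j => F ((Fintype.equivFin s).symm j), fun _ p => hF _ p,
    (Equiv.sum_comp (Fintype.equivFin s).symm fun i => tensorOp (F i)).symm⟩

theorem isSeparable_tensorOp {F : ∀ p, Matrix (ι p) (ι p) ℂ} (hF : ∀ p, (F p).PosSemidef) :
    IsSeparable (tensorOp F) := by
  simpa using isSeparable_sum_tensorOp fun _ : Unit => hF

theorem isSeparable_zero : IsSeparable (0 : Op ι) := by
  simpa using isSeparable_sum_tensorOp (ι := ι) (F := (isEmptyElim : Empty → _)) isEmptyElim

theorem isSeparable_one [∀ p, DecidableEq (ι p)] : IsSeparable (1 : Op ι) := by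
  rw [← tensorOp_one]
  exact isSeparable_tensorOp fun _ => Matrix.PosSemidef.one

namespace IsSeparable

theorem add {E E' : Op ι} (hE : IsSeparable E) (hE' : IsSeparable E') : IsSeparable (E + E') := by
  obtain ⟨-, r, F, hF, rfl⟩ := hE
  obtain ⟨-, r', F', hF', rfl⟩ := hE'
  simpa using isSeparable_sum_tensorOp (F := Sum.elim F F') (Sum.rec hF hF')

theorem sum {s : Type} [Fintype s] {E : s → Op ι} (hE : ∀ i, IsSeparable (E i)) :
    IsSeparable (∑ i, E i) :=
  Finset.sum_induction E IsSeparable (fun _ _ => add) isSeparable_zero fun i _ => hE i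

theorem smul [Nonempty P] {E : Op ι} (hE : IsSeparable E) {t : ℝ} (ht : 0 ≤ t) :
    IsSeparable (t • E) := by
  classical
  obtain ⟨-, r, F, hF, rfl⟩ := hE
  obtain ⟨k⟩ := ‹Nonempty P›
  have h_scale : ∀ i, t • tensorOp (F i) = tensorOp fun p => (if p = k then t else 1) • F i p :=
    fun i => by simp only [tensorOp_smul, Finset.prod_ite_eq', Finset.mem_univ, if_true]
  simp only [Finset.smul_sum, h_scale]
  refine isSeparable_sum_tensorOp fun i p => (hF i p).smul ?_
  split_ifs
  exacts [ht, zero_le_one]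

theorem conj [DecidableEq P] {κ : P → Type} [∀ p, Fintype (κ p)] {E : Op κ} (hE : IsSeparable E)
    (A : ∀ p, Matrix (κ p) (ι p) ℂ) : IsSeparable ((tensorOp A)ᴴ * E * tensorOp A) := by
  obtain ⟨-, r, F, hF, rfl⟩ := hE
  simp only [Matrix.mul_sum, Matrix.sum_mul, tensorOp_conjTranspose, tensorOp_mul]
  exact isSeparable_sum_tensorOp fun i p => (hF i p).conjTranspose_mul_mul_same (A p)

end IsSeparable

theorem exists_isSeparable_smul_one_sub_tensorOp [∀ p, DecidableEq (ι p)]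
    {F : ∀ p, Matrix (ι p) (ι p) ℂ} (hF : ∀ p, (F p).PosSemidef) :
    ∃ t : ℝ, IsSeparable (t • (1 : Op ι) - tensorOp F) := by
  classical
  choose t ht using fun p => exists_posSemidef_smul_one_sub (hF p).isHermitian
  let G : ∀ p, Bool → Matrix (ι p) (ι p) ℂ := fun p => Bool.rec (t p • 1 - F p) (F p)
  have hG : ∀ p b, (G p b).PosSemidef := fun p => Bool.rec (ht p) (hF p)
  have h_expand : (∏ p, t p) • (1 : Op ι) = ∑ b : P → Bool, tensorOp fun p => G p (b p) := by
    simp only [← tensorOp_sum, Fintype.sum_bool, G, add_sub_cancel, tensorOp_smul, tensorOp_one]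
  refine ⟨∏ p, t p, ?_⟩
  rw [h_expand, Fintype.sum_eq_add_sum_subtype_ne _ fun _ => true, add_sub_cancel_left]
  exact isSeparable_sum_tensorOp fun b p => hG p (b.1 p)

theorem IsSeparable.exists_smul_one_sub [∀ p, DecidableEq (ι p)] {E : Op ι}
    (hE : IsSeparable E) : ∃ t : ℝ, IsSeparable (t • (1 : Op ι) - E) := by
  obtain ⟨-, r, F, hF, rfl⟩ := hE
  choose t ht using fun i => exists_isSeparable_smul_one_sub_tensorOp (hF i)
  refine ⟨∑ i, t i, ?_⟩
  rw [Finset.sum_smul, ← Finset.sum_sub_distrib]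
  exact IsSeparable.sum ht

/-- The convex cone of separable operators, over which separable discrimination is a conic
program. -/
def separableCone [Nonempty P] (ι : P → Type) [∀ p, Fintype (ι p)] : PointedCone ℝ (Op ι) where
  carrier := {E | IsSeparable E}
  zero_mem' := isSeparable_zero
  add_mem' := IsSeparable.add
  smul_mem' t _ hE := hE.smul t.2

theorem IsBlockPositive.re_trace_mul_nonneg [DecidableEq P] [Nonempty P] {E σ : Op ι}
    (hE : IsBlockPositive E) (hσ : IsSeparable σ) : 0 ≤ (E * σ).trace.re := by
  obtain ⟨t, ht, h_trace⟩ : ∃ t : ℝ, 0 ≤ t ∧ (t : ℂ) = σ.trace :=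
    RCLike.nonneg_iff_exists_ofReal.1 hσ.1.trace_nonneg
  rcases ht.eq_or_lt with rfl | ht
  · rw [hσ.1.trace_eq_zero_iff.1 h_trace.symm, Matrix.mul_zero, Matrix.trace_zero, Complex.zero_re]
  · have h_state : (t⁻¹ • σ).trace = 1 := by
      rw [Matrix.trace_smul, ← h_trace, Complex.real_smul, ← Complex.ofReal_mul,
        inv_mul_cancel₀ ht.ne', Complex.ofReal_one]
    have h := hE.2 (t⁻¹ • σ) (hσ.smul (inv_nonneg.2 ht.le)) h_state
    rw [Matrix.mul_smul, Matrix.trace_smul, Complex.smul_re, smul_eq_mul] at h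
    exact (mul_nonneg_iff_of_pos_left (inv_pos.2 ht)).1 h

end Separable

section Locc

variable {P : Type} [Fintype P] [DecidableEq P] {ι : P → Type} [∀ p, Fintype (ι p)]
  [∀ p, DecidableEq (ι p)] {o : Type} [DecidableEq o]

theorem RealizedByLOCC.isSeparable {M : o → Op ι} (hM : RealizedByLOCC ι M) (b : o) :
    IsSeparable (M b) := by
  induction hM with
  | announce ι a =>
    dsimp only
    split_ifs
    exacts [isSeparable_one, isSeparable_zero]
  | round ι _ r κ A _ _ N _ ih => exact IsSeparable.sum fun j => (ih j).conj (A j)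

theorem RealizedByLOCC.sum_eq_one [Fintype o] {M : o → Op ι} (hM : RealizedByLOCC ι M) :
    ∑ b, M b = 1 := by
  induction hM with
  | announce ι a => simp only [Finset.sum_ite_eq', Finset.mem_univ, if_true]
  | round ι k r κ A hk hp N _ ih =>
    rw [Finset.sum_comm]
    simp only [← Matrix.sum_mul, ← Matrix.mul_sum, ih, Matrix.mul_one]
    exact sum_conjTranspose_tensorOp_mul_tensorOp hk hp

theorem RealizedByLOCC.isLOCCMeasurement [Fintype o] {M : o → Op ι} (hM : RealizedByLOCC ι M) :
    IsLOCCMeasurement M :=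
  ⟨⟨fun b => (hM.isSeparable b).1, hM.sum_eq_one⟩, hM⟩

theorem IsLOCCMeasurement.isSepMeasurement [Fintype o] {M : o → Op ι}
    (hM : IsLOCCMeasurement M) : IsSepMeasurement M :=
  ⟨hM.1, hM.2.isSeparable⟩

end Locc

section Duality

variable {P : Type} [Fintype P] [DecidableEq P] {ι : P → Type} [∀ p, Fintype (ι p)]
  {o : Type} [Fintype o]

namespace Ensemble

theorem nonempty_outcome (E : Ensemble ι o) : Nonempty o := by
  by_contra! h
  simpa using E.η_sum

theorem nonempty_index (E : Ensemble ι o) : Nonempty (∀ p, ι p) := by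
  obtain ⟨i⟩ := E.nonempty_outcome
  by_contra! h
  simpa using E.ρ_trace i

theorem success_smul (E : Ensemble ι o) (t : ℝ) (M : o → Op ι) :
    E.success (t • M) = t * E.success M := by
  simp only [success, Pi.smul_apply, Matrix.mul_smul, Matrix.trace_smul, Complex.smul_re,
    smul_eq_mul, Finset.mul_sum, mul_left_comm]

theorem success_nonneg (E : Ensemble ι o) {M : o → Op ι} (hM : ∀ i, (M i).PosSemidef) :
    0 ≤ E.success M :=
  Finset.sum_nonneg fun i _ => mul_nonneg (E.η_pos i).le
    (Complex.nonneg_iff.1 (trace_mul_nonneg (E.ρ_psd i) (hM i))).1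

/-- The feasible points of the dual of optimal separable discrimination, the problem of minimizing
`Tr H`: the operators `H` dominating all `η i • ρ i` in the order dual to the separable cone. -/
def IsDualFeasible (E : Ensemble ι o) (H : Op ι) : Prop :=
  H.IsHermitian ∧ ∀ i, IsBlockPositive (H - (E.η i : ℂ) • E.ρ i)

theorem IsDualFeasible.re_trace_mul_gap_nonneg [Nonempty P] {E : Ensemble ι o} {H : Op ι}
    (hH : E.IsDualFeasible H) {σ : Op ι} (hσ : IsSeparable σ) (i : o) :
    0 ≤ (σ * (H - (E.η i : ℂ) • E.ρ i)).trace.re := by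
  rw [Matrix.trace_mul_comm]
  exact (hH.2 i).re_trace_mul_nonneg hσ

variable [∀ p, DecidableEq (ι p)]

theorem success_announce [DecidableEq o] (E : Ensemble ι o) (a : o) :
    E.success (fun b => if b = a then 1 else 0) = E.η a := by
  rw [success, Fintype.sum_eq_single a fun b hb => by simp [hb]]
  simp [E.ρ_trace]

theorem IsPL.pos [DecidableEq o] {E : Ensemble ι o} {p : ℝ} (hp : E.IsPL p) : 0 < p := by
  obtain ⟨a⟩ := E.nonempty_outcome
  calc
    0 < E.η a := E.η_pos a
    _ ≤ p := hp.2 ⟨_, (RealizedByLOCC.announce ι a).isLOCCMeasurement, E.success_announce a⟩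

theorem IsPSEP.isPL_success [DecidableEq o] {E : Ensemble ι o} {M : o → Op ι}
    (h : E.IsPSEP (E.success M)) (hM : IsLOCCMeasurement M) : E.IsPL (E.success M) := by
  refine ⟨⟨M, hM, rfl⟩, ?_⟩
  rintro _ ⟨N, hN, rfl⟩
  exact h.2 ⟨N, hN.isSepMeasurement, rfl⟩

open scoped MatrixOrder in
theorem IsPSEP.success_le_mul [Nonempty P] {E : Ensemble ι o} {s a : ℝ} (hs : E.IsPSEP s)
    {M : o → Op ι} (hM : ∀ i, IsSeparable (M i)) (h_sum : ∑ i, M i = a • 1) :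
    E.success M ≤ a * s := by
  have := E.nonempty_index
  have h_nonneg : ∀ i ∈ Finset.univ, 0 ≤ M i := fun i _ => (hM i).1.nonneg
  have ha : 0 ≤ a := by
    have h := (Matrix.nonneg_iff_posSemidef.1 (Finset.sum_nonneg h_nonneg)).diag_nonneg
      (i := Classical.arbitrary _)
    simpa [h_sum] using h
  rcases ha.eq_or_lt with rfl | ha
  · rw [zero_smul, Finset.sum_eq_zero_iff_of_nonneg h_nonneg] at h_sum
    simp [success, h_sum]
  · have h_sep : ∀ i, IsSeparable ((a⁻¹ • M) i) := fun i => (hM i).smul (inv_nonneg.2 ha.le)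
    have h_one : ∑ i, (a⁻¹ • M) i = 1 := by
      simp only [Pi.smul_apply, ← Finset.smul_sum, h_sum, inv_smul_smul₀ ha.ne']
    have h_le := hs.2 ⟨a⁻¹ • M, ⟨⟨fun i => (h_sep i).1, h_one⟩, h_sep⟩, E.success_smul ..⟩
    rwa [inv_mul_le_iff₀ ha] at h_le

theorem IsPSEP.exists_isDualFeasible [Nonempty P] {E : Ensemble ι o} {s : ℝ} (hs : E.IsPSEP s) :
    ∃ H, E.IsDualFeasible H ∧ H.trace.re = s := by
  have := E.nonempty_index
  let reTrace : Op ι →ₗ[ℝ] ℝ := Complex.reLm ∘ₗ Matrix.traceLinearMap (∀ p, ι p) ℝ ℂ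
  let φ : o → Op ι →ₗ[ℝ] ℝ := fun i => E.η i • (reTrace ∘ₗ LinearMap.mulLeft ℝ (E.ρ i))
  let τ : Op ι →ₗ[ℝ] ℝ := (s / Fintype.card (∀ p, ι p)) • reTrace
  have hτ : τ 1 = s := by
    change s / Fintype.card (∀ p, ι p) * (1 : Op ι).trace.re = s
    rw [Matrix.trace_one, Complex.natCast_re]
    exact div_mul_cancel₀ s (Nat.cast_ne_zero.2 Fintype.card_ne_zero)
  obtain ⟨h, h_one, h_ge⟩ := exists_dual_functional (separableCone ι) isSeparable_one
    (fun _ hX => IsSeparable.exists_smul_one_sub hX) φ τ fun a M hM h_sum => by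
      rw [hτ]
      exact hs.success_le_mul hM h_sum
  obtain ⟨H, hH, hHh⟩ := exists_isHermitian_forall_eq_re_trace_mul h
  refine ⟨H, ⟨hH, fun i => ⟨?_, fun σ hσ _ => ?_⟩⟩, ?_⟩
  · exact hH.sub ((E.ρ_psd i).isHermitian.smul (Complex.conj_ofReal _))
  · have h_le : E.η i * (E.ρ i * σ).trace.re ≤ (H * σ).trace.re :=
      (h_ge i σ hσ).trans_eq (hHh σ hσ.1.isHermitian)
    simpa [Matrix.sub_mul] using h_le
  · rw [← hτ, ← h_one, hHh 1 Matrix.isHermitian_one, Matrix.mul_one]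

theorem sum_re_trace_mul_gap (E : Ensemble ι o) {M : o → Op ι} (hM : ∑ i, M i = 1) (H : Op ι) :
    ∑ i, (M i * (H - (E.η i : ℂ) • E.ρ i)).trace.re = H.trace.re - E.success M := by
  have h_trace : ∑ i, (M i * H).trace.re = H.trace.re := by
    rw [← Complex.re_sum, ← Matrix.trace_sum, ← Matrix.sum_mul, hM, Matrix.one_mul]
  simp only [Matrix.mul_sub, Matrix.mul_smul, Matrix.trace_sub, Matrix.trace_smul, Complex.sub_re,
    smul_eq_mul, Complex.re_ofReal_mul, Finset.sum_sub_distrib, h_trace, success,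
    Matrix.trace_mul_comm (E.ρ _)]

theorem IsDualFeasible.success_le [Nonempty P] {E : Ensemble ι o} {H : Op ι}
    (hH : E.IsDualFeasible H) {M : o → Op ι} (hM : IsSepMeasurement M) :
    E.success M ≤ H.trace.re := by
  rw [← sub_nonneg, ← E.sum_re_trace_mul_gap hM.1.2]
  exact Finset.sum_nonneg fun i _ => hH.re_trace_mul_gap_nonneg (hM.2 i) i

theorem IsDualFeasible.success_eq_iff [Nonempty P] {E : Ensemble ι o} {H : Op ι}
    (hH : E.IsDualFeasible H) {M : o → Op ι} (hM : IsSepMeasurement M) :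
    E.success M = H.trace.re ↔ ∀ i, (M i * (H - (E.η i : ℂ) • E.ρ i)).trace = 0 := by
  have h_real : ∀ i, (M i * (H - (E.η i : ℂ) • E.ρ i)).trace.im = 0 := fun i =>
    Complex.conj_eq_iff_im.1 (isSelfAdjoint_trace_mul (hM.1.1 i).isHermitian (hH.2 i).1)
  rw [eq_comm, ← sub_eq_zero, ← E.sum_re_trace_mul_gap hM.1.2,
    Finset.sum_eq_zero_iff_of_nonneg fun i _ => hH.re_trace_mul_gap_nonneg (hM.2 i) i]
  simp only [Finset.mem_univ, true_imp_iff, Complex.ext_iff, h_real, Complex.zero_re,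
    Complex.zero_im, and_true]

theorem isPSEP_success_iff [Nonempty P] (E : Ensemble ι o) {M : o → Op ι}
    (hM : IsSepMeasurement M) :
    E.IsPSEP (E.success M) ↔
      ∃ H, E.IsDualFeasible H ∧ ∀ i, (M i * (H - (E.η i : ℂ) • E.ρ i)).trace = 0 := by
  constructor
  · intro hs
    obtain ⟨H, hH, h_trace⟩ := hs.exists_isDualFeasible
    exact ⟨H, hH, (hH.success_eq_iff hM).1 h_trace.symm⟩
  · rintro ⟨H, hH, h_slack⟩
    refine ⟨⟨M, hM, rfl⟩, ?_⟩
    rintro _ ⟨N, hN, rfl⟩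
    exact (hH.success_le hN).trans_eq ((hH.success_eq_iff hM).2 h_slack).symm

end Ensemble

end Duality

section Sequence

variable {P S : Type} [Fintype P] [DecidableEq P] [Fintype S] [DecidableEq S]
  {ι : S → P → Type} [∀ l p, Fintype (ι l p)]

theorem stepTensor_mul (A B : ∀ l, Op (ι l)) :
    stepTensor A * stepTensor B = stepTensor fun l => A l * B l := by
  simp only [stepTensor, ← tensorOp_mul]
  exact Matrix.submatrix_mul_equiv (tensorOp A) (tensorOp B) _
    (Equiv.piComm fun p l => ι l p) _

variable {o : S → Type} [∀ l, Fintype (o l)] {E : ∀ l, Ensemble (ι l) (o l)}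
  {M : ∀ l, o l → Op (ι l)}

theorem seqEnsemble_success (hM : ∀ l i, (M l i).IsHermitian) :
    (seqEnsemble E).success (fun c => stepTensor fun l => M l (c l)) =
      ∏ l, (E l).success (M l) := by
  have h_real : ∀ l i, (((E l).ρ i * M l i).trace.re : ℂ) = ((E l).ρ i * M l i).trace := fun l i =>
    Complex.conj_eq_iff_re.1 (isSelfAdjoint_trace_mul ((E l).ρ_psd i).isHermitian (hM l i))
  simp only [Ensemble.success, Fintype.prod_sum]
  refine Finset.sum_congr rfl fun c _ => ?_
  simp only [seqEnsemble, stepTensor_mul, stepTensor_trace, Finset.prod_mul_distrib]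
  rw [← Complex.ofReal_re (∏ l, ((E l).ρ (c l) * M l (c l)).trace.re), Complex.ofReal_prod]
  simp only [h_real]

variable [∀ l p, DecidableEq (ι l p)] [∀ l, DecidableEq (o l)]

theorem IsLOCCMeasurement.stepTensor (hM : ∀ l, IsLOCCMeasurement (M l)) :
    IsLOCCMeasurement fun c : ∀ l, o l => MultiParty.stepTensor fun l => M l (c l) :=
  (RealizedByLOCC.stepTensor fun l => (hM l).2).isLOCCMeasurement

theorem IsLOCCMeasurement.seqEnsemble_success (hM : ∀ l, IsLOCCMeasurement (M l)) :
    (seqEnsemble E).success (fun c => MultiParty.stepTensor fun l => M l (c l)) =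
      ∏ l, (E l).success (M l) :=
  MultiParty.seqEnsemble_success fun l i => ((hM l).1.1 i).isHermitian

theorem Ensemble.IsPL.of_seqEnsemble (hM : ∀ l, IsLOCCMeasurement (M l))
    (h : (seqEnsemble E).IsPL ((seqEnsemble E).success fun c => stepTensor fun l => M l (c l)))
    (l : S) : (E l).IsPL ((E l).success (M l)) := by
  refine ⟨⟨M l, hM l, rfl⟩, ?_⟩
  rintro _ ⟨N, hN, rfl⟩
  rw [IsLOCCMeasurement.seqEnsemble_success hM] at h
  have h_pos : 0 < ∏ l' ∈ Finset.univ \ {l}, (E l').success (M l') :=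
    (Finset.prod_nonneg fun l' _ => (E l').success_nonneg (hM l').1.1).lt_of_ne' <|
      Finset.prod_ne_zero_iff.2 fun l' _ =>
        Finset.prod_ne_zero_iff.1 h.pos.ne' l' (Finset.mem_univ l')
  have hN_update : ∀ l', IsLOCCMeasurement (Function.update M l N l') :=
    (Function.forall_update_iff M fun l' => IsLOCCMeasurement).2 ⟨hN, fun l' _ => hM l'⟩
  have h_le := h.2 ⟨_, IsLOCCMeasurement.stepTensor hN_update,
    IsLOCCMeasurement.seqEnsemble_success hN_update⟩
  simp only [Function.apply_update fun l' => (E l').success] at h_le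
  rw [Finset.prod_update_of_mem (Finset.mem_univ l),
    Finset.prod_eq_mul_prod_sdiff_singleton_of_mem (Finset.mem_univ l)] at h_le
  exact le_of_mul_le_mul_right h_le h_pos

end Sequence

end MultiParty

open MultiParty in
theorem theorem4_general {P S : Type} [Fintype P] [DecidableEq P] [Nonempty P] [Fintype S]
    [DecidableEq S] {ι : S → P → Type} [∀ l p, Fintype (ι l p)] [∀ l p, DecidableEq (ι l p)]
    {o : S → Type} [∀ l, Fintype (o l)] [∀ l, DecidableEq (o l)]
    (E : ∀ l, Ensemble (ι l) (o l)) :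
    (∃ (p : S → ℝ) (q s : ℝ),
      (∀ l, (E l).IsPL (p l)) ∧ (seqEnsemble E).IsPL q ∧ (seqEnsemble E).IsPSEP s ∧
      ∏ l, p l = q ∧ q = s) ↔
    ∃ (M : ∀ l, o l → Op (ι l)) (H : Op fun p => ∀ l, ι l p),
      (∀ l, IsLOCCMeasurement (M l)) ∧ H.IsHermitian ∧
      ∀ c : ∀ l, o l,
        IsBlockPositive (H - ((seqEnsemble E).η c : ℂ) • (seqEnsemble E).ρ c) ∧
        (stepTensor (fun l => M l (c l)) *
          (H - ((seqEnsemble E).η c : ℂ) • (seqEnsemble E).ρ c)).trace = 0 := by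
  constructor
  · rintro ⟨p, _, _, hp, -, hs, rfl, rfl⟩
    choose M hM hMp using fun l => (hp l).1
    simp only [← hMp, ← IsLOCCMeasurement.seqEnsemble_success hM] at hs
    obtain ⟨H, ⟨hH, h_block⟩, h_slack⟩ := ((seqEnsemble E).isPSEP_success_iff
      (IsLOCCMeasurement.stepTensor hM).isSepMeasurement).1 hs
    exact ⟨M, H, hM, hH, fun c => ⟨h_block c, h_slack c⟩⟩
  · rintro ⟨M, H, hM, hH, hc⟩
    have h_locc := IsLOCCMeasurement.stepTensor hM
    have h_sep := ((seqEnsemble E).isPSEP_success_iff h_locc.isSepMeasurement).2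
      ⟨H, ⟨hH, fun c => (hc c).1⟩, fun c => (hc c).2⟩
    have h_pl := h_sep.isPL_success h_locc
    exact ⟨_, _, _, Ensemble.IsPL.of_seqEnsemble hM h_pl, h_pl, h_sep,
      (IsLOCCMeasurement.seqEnsemble_success hM).symm, rfl⟩

theorem theorem4 {m L : ℕ} (hm : 1 ≤ m) (d : Fin L → Fin m → ℕ) (n : Fin L → ℕ)
    (E : ∀ l, MultiParty.Ensemble (fun k => Fin (d l k)) (Fin (n l))) :
    (∃ (p : Fin L → ℝ) (q s : ℝ),
      (∀ l, (E l).IsPL (p l)) ∧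
      (MultiParty.seqEnsemble E).IsPL q ∧
      (MultiParty.seqEnsemble E).IsPSEP s ∧
      ∏ l, p l = q ∧ q = s) ↔
    ∃ (M : ∀ l, Fin (n l) → MultiParty.Op (fun k => Fin (d l k)))
      (H : MultiParty.Op (fun k => ∀ l, Fin (d l k))),
      (∀ l, MultiParty.IsLOCCMeasurement (M l)) ∧
      H.IsHermitian ∧
      ∀ c : ∀ l, Fin (n l),
        MultiParty.IsBlockPositive
          (H - ((MultiParty.seqEnsemble E).η c : ℂ) • (MultiParty.seqEnsemble E).ρ c) ∧
        (MultiParty.stepTensor (fun l => M l (c l)) *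
          (H - ((MultiParty.seqEnsemble E).η c : ℂ) •
            (MultiParty.seqEnsemble E).ρ c)).trace = 0 := by
  have : Nonempty (Fin m) := ⟨⟨0, hm⟩⟩
  exact theorem4_general E
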